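/- Let $n,n_u,N$ be natural numbers and consider the finite-horizon linear system $$x_1=D_0w_0,\qquad x_{t+1}=A_tx_t+B_tu_t+D_tw_t\quad(t=1,\dots,N-1),$$ with states $x_t\in\mathbb{R}^n$, disturbances $w_t\in\mathbb{R}^n$, controls $u_t\in\mathbb{R}^{n_u}$, real matrices $A_t,D_t\in\mathbb{R}^{n\times n}$, $B_t\in\mathbb{R}^{n\times n_u}$, where $D_0,\dots,D_{N-1}$ are invertible, under static state feedback $u_t=K_tx_t$ with $\mathbf{K}=(K_1,\dots,K_{N-1})$, $K_t\in\mathbb{R}^{n_u\times n}$. Put $\tilde A_t=A_t+B_tK_t$. Let $\mathcal{A}_{\mathbf{K}}\in\mathbb{R}^{nN\times nN}$ be the matrix of the map $(w_0,\dots,w_{N-1})\mapsto(x_1,\dots,x_N)$; with block indices $i,j=0,\dots,N-1$, its $(i,j)$ block is $\tilde A_i\tilde A_{i-1}\cdots\tilde A_{j+1}D_j$ for $j\le i$ (so $D_i$ for $j=i$) and $0$ for $j>i$. For $X\in\mathbb{R}^{nN\times nN}$ let $\sigma(X)\in\mathbb{R}^{nN}$ be the vector of its singular values, with multiplicity, in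 decreasing order. Let $f:\mathbb{R}^{nN}\to(-\infty,+\infty]$ be convex, lower semicontinuous and absolutely symmetric (invariant under permutations and sign changes of the coordinates), let $R$ be a convex function of $\mathbf{K}$ on the space of all gain families with values in $(-\infty,+\infty]$, and let $\mathcal{C}$ be a convex set of gain families. Then: 1. For every $\mathbf{K}$ the matrix $\mathcal{A}_{\mathbf{K}}$ is invertible, and its inverse is the block-bidiagonal matrix with diagonal blocks $D_i^{-1}$ ($0\le i\le N-1$), blocks $-D_i^{-1}(A_i+B_iK_i)$ in position $(i,i-1)$ ($1\le i\le N-1$), and all other blocks zero. In particular $\mathbf{K}\mapsto\mathcal{A}_{\mathbf{K}}^{-1}$ is affine. 2. The problem $$\min_{\mathbf{K}\in\mathcal{C}}\ f\bigl(\sigma(\mathcal{A}_{\mathbf{K}}^{-1})\bigr)+R(\mathbf{K})$$ is a convex optimization problem: the feasible set $\mathcal{C}$ is convex, and the objective is a convex function of $\mathbf{K}$ on $\mathcal{C}$ with values in $(-\infty,+\infty]$. -/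

import Mathlib

noncomputable section

/-- A function `g : E → EReal` is convex on `s` as an extended-real-valued function: `s` is convex,
`g` takes values in `(-∞, +∞]` on `s`, and Jensen's inequality for two points holds on `s`.
The weights are positive, so that no product `0 * (+∞)` occurs. -/
def ExtConvexOn {E : Type*} [AddCommGroup E] [Module ℝ E] (s : Set E) (g : E → EReal) : Prop :=
  Convex ℝ s ∧ (∀ x ∈ s, g x ≠ ⊥) ∧
    ∀ x ∈ s, ∀ y ∈ s, ∀ a b : ℝ, 0 < a → 0 < b → a + b = 1 →
      g (a • x + b • y) ≤ (a : EReal) * g x + (b : EReal) * g y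

/-- The problem "minimize `F x` subject to `x ∈ C`" is a convex optimization problem: the feasible
set is convex and the objective is a convex function on it. -/
structure IsConvexProblem {E : Type*} [AddCommGroup E] [Module ℝ E]
    (C : Set E) (F : E → EReal) : Prop where
  feasible_convex : Convex ℝ C
  objective_convex : ExtConvexOn C F

/-- A function on `ℝᵐ` is absolutely symmetric if it is invariant under permutations and sign
changes of the coordinates. -/
def AbsolutelySymmetric {m : ℕ} (f : (Fin m → ℝ) → EReal) : Prop :=
  ∀ (π : Equiv.Perm (Fin m)) (ε : Fin m → ℤˣ) (x : Fin m → ℝ),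
    f (fun i => ((ε i : ℤ) : ℝ) * x (π i)) = f x

/-- The vector of the `m` singular values of an `m × m` real matrix, counted with multiplicity and
in decreasing order. -/
def singularValueVector {ι : Type*} [Fintype ι] [DecidableEq ι] (X : Matrix ι ι ℝ) :
    Fin (Fintype.card ι) → ℝ :=
  fun i => (Matrix.toEuclideanLin X).singularValues i

/-- Families of feedback gains `K = (K_t)`, `t = 1, …, N - 1`, with `K_t ∈ ℝ^{nu × n}`. -/
abbrev Gains (n nu N : ℕ) : Type :=
  {t : ℕ // 1 ≤ t ∧ t < N} → Matrix (Fin nu) (Fin n) ℝ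

/-- The closed-loop matrix `A_t + B_t K_t`, for `1 ≤ t ≤ N - 1` (and `A_t` at other times, which
play no role). -/
def closedLoop {n nu N : ℕ} (A : ℕ → Matrix (Fin n) (Fin n) ℝ)
    (B : ℕ → Matrix (Fin n) (Fin nu) ℝ) (K : Gains n nu N) (t : ℕ) : Matrix (Fin n) (Fin n) ℝ :=
  if h : 1 ≤ t ∧ t < N then A t + B t * K ⟨t, h⟩ else A t

/-- The product `M_{j+k} ⋯ M_{j+2} M_{j+1}` of `k` consecutive matrices (the identity if `k = 0`). -/
def transition {n : ℕ} (M : ℕ → Matrix (Fin n) (Fin n) ℝ) (j : ℕ) : ℕ → Matrix (Fin n) (Fin n) ℝ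
  | 0 => 1
  | k + 1 => M (j + k + 1) * transition M j k

/-- The matrix of the map from disturbances `(w_0, …, w_{N-1})` to states `(x_1, …, x_N)` of the
closed-loop system `x_1 = D_0 w_0`, `x_{t+1} = (A_t + B_t K_t) x_t + D_t w_t`.
Block row `i` belongs to `x_{i+1}`, block column `j` to `w_j`; the block is
`Ã_i Ã_{i-1} ⋯ Ã_{j+1} D_j` for `j ≤ i` and `0` above the diagonal. -/
def responseMatrix {n nu N : ℕ} (A : ℕ → Matrix (Fin n) (Fin n) ℝ)
    (B : ℕ → Matrix (Fin n) (Fin nu) ℝ) (D : ℕ → Matrix (Fin n) (Fin n) ℝ) (K : Gains n nu N) :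
    Matrix (Fin N × Fin n) (Fin N × Fin n) ℝ :=
  fun p q =>
    (if (q.1 : ℕ) ≤ (p.1 : ℕ) then
      transition (closedLoop A B K) q.1 ((p.1 : ℕ) - (q.1 : ℕ)) * D q.1
    else 0 : Matrix (Fin n) (Fin n) ℝ) p.2 q.2

/-- The block-bidiagonal matrix with diagonal blocks `D_i⁻¹` and subdiagonal blocks
`-D_i⁻¹ (A_i + B_i K_i)` in block position `(i, i - 1)`. -/
def bidiagonalMatrix {n nu N : ℕ} (A : ℕ → Matrix (Fin n) (Fin n) ℝ)
    (B : ℕ → Matrix (Fin n) (Fin nu) ℝ) (D : ℕ → Matrix (Fin n) (Fin n) ℝ) (K : Gains n nu N) :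
    Matrix (Fin N × Fin n) (Fin N × Fin n) ℝ :=
  fun p q =>
    (if p.1 = q.1 then (D p.1)⁻¹
    else if (p.1 : ℕ) = (q.1 : ℕ) + 1 then -((D p.1)⁻¹ * closedLoop A B K p.1)
    else 0 : Matrix (Fin n) (Fin n) ℝ) p.2 q.2

end

open scoped InnerProductSpace

/-! Solving the dynamics for the disturbance, `w_t = D_t⁻¹ (x_{t+1} - Ã_t x_t)`, exhibits the
inverse response: it is block bidiagonal and affine in the gains. It remains to see that `f ∘ σ` is
convex on matrices. Let `Z = aX + bY` have singular frames `p`, `q`. Then `σ(Z)` is the diagonal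
`d(Z)` of `Z` in these frames. With the frames fixed, `d` is linear, so `σ(Z) = a d(X) + b d(Y)`,
and convexity of `f` reduces the claim to `f (d X) ≤ f (σ X)` and the same for `Y`. Now `d(X) = M
σ(X)` with `|M|` dominated entrywise by a doubly stochastic matrix. By Birkhoff's theorem `d(X)`
lies in every convex set containing the signed permutations of `σ(X)`, in particular in the sublevel
set of `f` at height `f (σ X)`. -/

/-- Multiplying a nonnegative real number into a sum in `EReal` is distributive. -/
theorem EReal.coe_mul_add {a : ℝ} (ha : 0 ≤ a) (x y : EReal) :
    (a : EReal) * (x + y) = a * x + a * y :=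
  EReal.left_distrib_of_nonneg_of_ne_top (by exact_mod_cast ha) (EReal.coe_ne_top a) x y

theorem EReal.coe_mul_add_coe_mul_self {a b : ℝ} (ha : 0 ≤ a) (hb : 0 ≤ b) (hab : a + b = 1)
    (x : EReal) : (a : EReal) * x + (b : EReal) * x = x := by
  rw [← EReal.right_distrib_of_nonneg (by exact_mod_cast ha) (by exact_mod_cast hb),
    ← EReal.coe_add, hab, EReal.coe_one, one_mul]

/-! ### Calculus of extended-real-valued convex functions. -/

namespace ExtConvexOn

variable {E F : Type*} [AddCommGroup E] [Module ℝ E] [AddCommGroup F] [Module ℝ F]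

theorem mono {s t : Set E} {g : E → EReal} (hg : ExtConvexOn t g) (hst : s ⊆ t)
    (hs : Convex ℝ s) : ExtConvexOn s g :=
  ⟨hs, fun x hx => hg.2.1 x (hst hx), fun x hx y hy => hg.2.2 x (hst hx) y (hst hy)⟩

theorem add {s : Set E} {g h : E → EReal} (hg : ExtConvexOn s g) (hh : ExtConvexOn s h) :
    ExtConvexOn s (fun x => g x + h x) := by
  refine ⟨hg.1, fun x hx => ?_, fun x hx y hy a b ha hb hab => ?_⟩
  · simpa [EReal.add_eq_bot_iff] using ⟨hg.2.1 x hx, hh.2.1 x hx⟩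
  · rw [EReal.coe_mul_add ha.le, EReal.coe_mul_add hb.le, add_add_add_comm]
    exact add_le_add (hg.2.2 x hx y hy a b ha hb hab) (hh.2.2 x hx y hy a b ha hb hab)

theorem comp_affineMap {g : F → EReal} (hg : ExtConvexOn Set.univ g) (L : E →ᵃ[ℝ] F) :
    ExtConvexOn Set.univ (fun x => g (L x)) := by
  refine ⟨convex_univ, fun x _ => hg.2.1 _ trivial, fun x _ y _ a b ha hb hab => ?_⟩
  simp only [Convex.combo_affine_apply hab]
  exact hg.2.2 _ trivial _ trivial a b ha hb hab

/-- Turns the inequality `f (d X) ≤ f (σ X)` into membership in a convex set of real vectors, where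
Birkhoff's theorem applies. -/
theorem convex_sublevel {g : E → EReal} (hg : ExtConvexOn Set.univ g) (c : EReal) :
    Convex ℝ {x | g x ≤ c} := by
  refine convex_iff_forall_pos.2 fun x hx y hy a b ha hb hab => ?_
  refine (hg.2.2 x trivial y trivial a b ha hb hab).trans ?_
  rw [← EReal.coe_mul_add_coe_mul_self ha.le hb.le hab c]
  exact add_le_add (mul_le_mul_of_nonneg_left hx (by exact_mod_cast ha.le))
    (mul_le_mul_of_nonneg_left hy (by exact_mod_cast hb.le))

end ExtConvexOn

/-! ### Signed permutations and doubly stochastic matrices. -/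

/-- A convex set that contains all sign changes of `y` contains all coordinatewise contractions
of `y`. -/
theorem Convex.mul_mem_of_forall_sign_mul_mem {ι : Type*} [Finite ι] {s : Set (ι → ℝ)}
    (hs : Convex ℝ s) {y : ι → ℝ} (h : ∀ ε : ι → ℤˣ, (fun i => ((ε i : ℤ) : ℝ) * y i) ∈ s)
    {t : ι → ℝ} (ht : ∀ i, |t i| ≤ 1) : (fun i => t i * y i) ∈ s := by
  -- The cube `[-1, 1]^ι` is the convex hull of its vertices, the sign vectors.
  have hsub : Set.pi Set.univ (fun _ : ι => ({-1, 1} : Set ℝ)) ⊆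
      (LinearMap.mulRight ℝ y) ⁻¹' s := by
    intro e he
    have hsign : ∀ i, ∃ ε : ℤˣ, ((ε : ℤ) : ℝ) = e i := by
      intro i
      rcases he i trivial with hi | hi
      · exact ⟨-1, by simp [hi]⟩
      · exact ⟨1, by simp_all⟩
    choose ε hε using hsign
    have := h ε
    simp only [hε] at this
    exact this
  have hhull := convexHull_min hsub (hs.linear_preimage _)
  rw [convexHull_pi] at hhull
  refine hhull fun i _ => ?_
  rw [convexHull_pair, segment_eq_Icc (by norm_num)]
  exact abs_le.1 (ht i)

/-- A convex set that contains all signed permutations of `x` contains `M x` for every matrix `M`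
that is dominated entrywise in absolute value by a doubly stochastic matrix. -/
theorem Convex.mulVec_mem_of_abs_le_doublyStochastic {ι : Type*} [Fintype ι] [DecidableEq ι]
    {s : Set (ι → ℝ)} (hs : Convex ℝ s) {x : ι → ℝ}
    (h : ∀ (π : Equiv.Perm ι) (ε : ι → ℤˣ), (fun i => ((ε i : ℤ) : ℝ) * x (π i)) ∈ s)
    {M S : Matrix ι ι ℝ} (hS : S ∈ doublyStochastic ℝ ι) (hMS : ∀ i j, |M i j| ≤ S i j) :
    M.mulVec x ∈ s := by
  obtain ⟨w, hw0, hw1, hwS⟩ := exists_eq_sum_perm_of_mem_doublyStochastic hS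
  -- Where `S i j = 0`, domination forces `M i j = 0`, so the convention `x / 0 = 0` is harmless.
  have hfac : ∀ i j, M i j = M i j / S i j * S i j := by
    intro i j
    by_cases h0 : S i j = 0
    · have := hMS i j
      rw [h0, abs_nonpos_iff] at this
      simp [this]
    · field_simp
  have hle : ∀ i j, |M i j / S i j| ≤ 1 := by
    intro i j
    have hpos := (abs_nonneg _).trans (hMS i j)
    rw [abs_div, abs_of_nonneg hpos]
    exact div_le_one_of_le₀ (hMS i j) hpos
  have hsum : M.mulVec x =
      ∑ π : Equiv.Perm ι, w π • fun i => M i (π i) / S i (π i) * x (π i) := by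
    ext i
    have hSe : ∀ j, S i j = ∑ π, w π * (if π i = j then 1 else 0) := by
      intro j
      rw [← hwS, Matrix.sum_apply]
      simp [Equiv.Perm.permMatrix, PEquiv.toMatrix_apply, eq_comm]
    have : ∀ j, M i j * x j =
        ∑ π, w π * ((if π i = j then 1 else 0) * (M i j / S i j * x j)) := by
      intro j
      calc M i j * x j = M i j / S i j * x j * S i j := by rw [mul_right_comm, ← hfac]
        _ = M i j / S i j * x j * ∑ π, w π * (if π i = j then 1 else 0) := by rw [← hSe]
        _ = _ := by
          rw [Finset.mul_sum]
          exact Finset.sum_congr rfl fun π _ => by ring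
    simp only [Matrix.mulVec, dotProduct, this, Finset.sum_apply, Pi.smul_apply, smul_eq_mul]
    rw [Finset.sum_comm]
    simp
  rw [hsum]
  exact hs.sum_mem (fun π _ => hw0 π) hw1 fun π _ =>
    hs.mul_mem_of_forall_sign_mul_mem (h π) fun i => hle i (π i)

/-! ### Singular value decomposition and convexity of spectral functions. -/

section SingularValues

variable {E F : Type*} [NormedAddCommGroup E] [InnerProductSpace ℝ E] [FiniteDimensional ℝ E]
  [NormedAddCommGroup F] [InnerProductSpace ℝ F] [FiniteDimensional ℝ F]

/-- The singular value decomposition of a linear map between spaces of the same dimension. -/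
theorem LinearMap.exists_orthonormalBasis_apply_eq_singularValues_smul {n : ℕ}
    (hE : Module.finrank ℝ E = n) (hF : Module.finrank ℝ F = n) (T : E →ₗ[ℝ] F) :
    ∃ (v : OrthonormalBasis (Fin n) ℝ E) (u : OrthonormalBasis (Fin n) ℝ F),
      ∀ i, T (v i) = T.singularValues i • u i := by
  set v := T.isSymmetric_adjoint_comp_self.eigenvectorBasis hE with hv
  have hinner : ∀ i j, ⟪T (v i), T (v j)⟫_ℝ = if i = j then T.singularValues i ^ 2 else 0 := by
    intro i j
    rw [← LinearMap.adjoint_inner_left, ← LinearMap.comp_apply, hv,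
      LinearMap.IsSymmetric.apply_eigenvectorBasis, real_inner_smul_left,
      ← T.sq_singularValues_fin hE, orthonormal_iff_ite.1 (OrthonormalBasis.orthonormal _)]
    split_ifs <;> simp
  -- The `T (v i)` are orthogonal with norms the singular values. Only the nonzero ones can be
  -- normalized; the rest of `u` is an arbitrary orthonormal completion.
  let s : Set (Fin n) := {i | T.singularValues i ≠ 0}
  have hu : Orthonormal ℝ
      (s.domRestrict fun i => (T.singularValues i)⁻¹ • T (v i)) := by
    rw [orthonormal_iff_ite]
    rintro ⟨i, hi⟩ ⟨j, hj⟩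
    have hi' : T.singularValues i ≠ 0 := hi
    simp only [Set.domRestrict_apply, real_inner_smul_left, real_inner_smul_right, hinner,
      Subtype.mk.injEq]
    split_ifs with hij
    · subst hij
      field_simp
    · simp
  obtain ⟨u, hu⟩ := hu.exists_orthonormalBasis_extension_of_card_eq (by simp [hF])
  refine ⟨v, u, fun i => ?_⟩
  by_cases hi : T.singularValues i = 0
  · have := hinner i i
    rw [if_pos rfl, hi, zero_pow two_ne_zero, inner_self_eq_zero] at this
    rw [this, hi, zero_smul]
  · rw [hu i hi, smul_inv_smul₀ hi]

/-- For orthonormal bases `p`, `q`, the vector of the `⟪p i, T (q i)⟫` lies in every convex set that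
contains all signed permutations of the vector of singular values of `T`. -/
theorem Convex.inner_apply_mem_of_singularValues {n : ℕ} {s : Set (Fin n → ℝ)}
    (hs : Convex ℝ s) (T : E →ₗ[ℝ] F)
    (h : ∀ (π : Equiv.Perm (Fin n)) (ε : Fin n → ℤˣ),
      (fun i => ((ε i : ℤ) : ℝ) * T.singularValues (π i)) ∈ s)
    (p : OrthonormalBasis (Fin n) ℝ F) (q : OrthonormalBasis (Fin n) ℝ E) :
    (fun i => ⟪p i, T (q i)⟫_ℝ) ∈ s := by
  have hE : Module.finrank ℝ E = n := by simpa using Module.finrank_eq_card_basis q.toBasis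
  have hF : Module.finrank ℝ F = n := by simpa using Module.finrank_eq_card_basis p.toBasis
  obtain ⟨v, u, hvu⟩ := T.exists_orthonormalBasis_apply_eq_singularValues_smul hE hF
  -- Expanding `q i` in `v` gives the diagonal as `M` applied to the singular values. `S` bounds
  -- `|M|` by `|xy| ≤ (x² + y²) / 2`, and Parseval makes its row and column sums 1.
  let M : Matrix (Fin n) (Fin n) ℝ := .of fun i j => ⟪p i, u j⟫_ℝ * ⟪v j, q i⟫_ℝ
  let S : Matrix (Fin n) (Fin n) ℝ := .of fun i j => (⟪p i, u j⟫_ℝ ^ 2 + ⟪v j, q i⟫_ℝ ^ 2) / 2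
  have hS : S ∈ doublyStochastic ℝ (Fin n) := by
    rw [mem_doublyStochastic_iff_sum]
    refine ⟨fun i j => by simp only [S, Matrix.of_apply]; positivity, fun i => ?_, fun j => ?_⟩
    · simp only [S, Matrix.of_apply]
      rw [← Finset.sum_div, Finset.sum_add_distrib, u.sum_sq_inner_left, v.sum_sq_inner_right]
      simp
    · simp only [S, Matrix.of_apply]
      rw [← Finset.sum_div, Finset.sum_add_distrib, p.sum_sq_inner_right, q.sum_sq_inner_left]
      simp
  have hMS : ∀ i j, |M i j| ≤ S i j := by
    intro i j
    simp only [M, S, Matrix.of_apply]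
    rw [abs_le]
    constructor <;> nlinarith [sq_nonneg (⟪p i, u j⟫_ℝ + ⟪v j, q i⟫_ℝ),
      sq_nonneg (⟪p i, u j⟫_ℝ - ⟪v j, q i⟫_ℝ)]
  convert hs.mulVec_mem_of_abs_le_doublyStochastic (x := fun i => T.singularValues i) h hS hMS
    using 2 with i
  conv_lhs => rw [← v.sum_repr' (q i)]
  simp only [map_sum, map_smul, hvu, inner_sum, real_inner_smul_right]
  refine Finset.sum_congr rfl fun j _ => ?_
  simp only [M, Matrix.of_apply]
  ring

end SingularValues

/-- A convex absolutely symmetric function of the singular values is a convex function of the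
matrix. -/
theorem ExtConvexOn.comp_singularValueVector {ι : Type*} [Fintype ι] [DecidableEq ι]
    {f : (Fin (Fintype.card ι) → ℝ) → EReal} (hf : ExtConvexOn Set.univ f)
    (hsymm : AbsolutelySymmetric f) :
    ExtConvexOn Set.univ fun X : Matrix ι ι ℝ => f (singularValueVector X) := by
  refine ⟨convex_univ, fun X _ => hf.2.1 _ trivial, fun X _ Y _ a b ha hb hab => ?_⟩
  have hE : Module.finrank ℝ (EuclideanSpace ℝ ι) = Fintype.card ι := finrank_euclideanSpace
  obtain ⟨q, p, hqp⟩ := (Matrix.toEuclideanLin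
    (a • X + b • Y)).exists_orthonormalBasis_apply_eq_singularValues_smul hE hE
  let d (Z : Matrix ι ι ℝ) : Fin (Fintype.card ι) → ℝ :=
    fun i => ⟪p i, Matrix.toEuclideanLin Z (q i)⟫_ℝ
  have hd : singularValueVector (a • X + b • Y) = a • d X + b • d Y := by
    have : singularValueVector (a • X + b • Y) = d (a • X + b • Y) := by
      ext i
      simp only [d, hqp, real_inner_smul_right]
      simp [singularValueVector]
    rw [this]
    ext i
    simp [d, inner_add_right, real_inner_smul_right]
  have hle : ∀ Z, f (d Z) ≤ f (singularValueVector Z) := fun Z =>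
    (hf.convex_sublevel (f (singularValueVector Z))).inner_apply_mem_of_singularValues
      (Matrix.toEuclideanLin Z) (fun π ε => (hsymm π ε (singularValueVector Z)).le) p q
  simp only [hd]
  refine (hf.2.2 _ trivial _ trivial a b ha hb hab).trans (add_le_add ?_ ?_)
  · exact mul_le_mul_of_nonneg_left (hle X) (by exact_mod_cast ha.le)
  · exact mul_le_mul_of_nonneg_left (hle Y) (by exact_mod_cast hb.le)

/-! ### The closed-loop response and its inverse. -/

section Response

variable {n nu N : ℕ} (A : ℕ → Matrix (Fin n) (Fin n) ℝ) (B : ℕ → Matrix (Fin n) (Fin nu) ℝ)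
  (D : ℕ → Matrix (Fin n) (Fin n) ℝ)

/-- Below the diagonal the two contributions cancel, because the transition from `j` to `i` is `Ã_i`
times the transition from `j` to `i - 1`. -/
theorem bidiagonalMatrix_mul_responseMatrix (hD : ∀ t < N, IsUnit (D t)) (K : Gains n nu N) :
    bidiagonalMatrix A B D K * responseMatrix A B D K = 1 := by
  set M := closedLoop A B K
  let G : ℕ → ℕ → Matrix (Fin n) (Fin n) ℝ := fun i j =>
    if j ≤ i then transition M j (i - j) * D j else 0
  let H : Fin N → Fin N → Matrix (Fin n) (Fin n) ℝ := fun i j =>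
    if i = j then (D i)⁻¹ else if (i : ℕ) = j + 1 then -((D i)⁻¹ * M i) else 0
  have hblock : ∀ i j : Fin N, ∑ k, H i k * G k j = if i = j then 1 else 0 := by
    intro i j
    have hDi : (D i)⁻¹ * D i = 1 :=
      Matrix.nonsing_inv_mul _ ((Matrix.isUnit_iff_isUnit_det _).1 (hD i i.2))
    obtain ⟨i, hi⟩ := i
    obtain ⟨j, hj⟩ := j
    -- Splits off the diagonal term `k = i`; of the others only `k = i - 1` survives, and none if `i
    -- = 0`.
    rw [← Finset.add_sum_erase _ _ (Finset.mem_univ (⟨i, hi⟩ : Fin N))]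
    cases i with
    | zero =>
      rw [Finset.sum_eq_zero]
      · by_cases h0 : j = 0
        · subst h0; simpa [H, G, transition] using hDi
        · simp [H, G, h0, Ne.symm h0]
      · rintro k hk
        have : ¬ (⟨0, hi⟩ : Fin N) = k := fun h => (Finset.ne_of_mem_erase hk) h.symm
        simp [H, this]
    | succ i =>
      rw [Finset.sum_eq_single (⟨i, by omega⟩ : Fin N)]
      · rcases lt_trichotomy (i + 1) j with h | h | h
        · have h1 : ¬ j ≤ i + 1 := by omega
          have h2 : ¬ j ≤ i := by omega
          have h3 : ¬ i + 1 = j := by omega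
          simp [H, G, h1, h2, h3]
        · subst h
          simpa [H, G, transition] using hDi
        · have h1 : j ≤ i + 1 := by omega
          have h2 : j ≤ i := by omega
          have h3 : ¬ i + 1 = j := by omega
          have h4 : i + 1 - j = (i - j) + 1 := by omega
          simp [H, G, h1, h2, h3, h4, transition, mul_assoc]
      · intro k hk hki
        have h1 : ¬ (⟨i + 1, hi⟩ : Fin N) = k := fun h => (Finset.ne_of_mem_erase hk) h.symm
        have h2 : ¬ i = (k : ℕ) := fun h => hki (Fin.ext h.symm)
        simp [H, h1, h2]
      · intro h
        simp at h
  ext ⟨i, a⟩ ⟨j, b⟩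
  have := congrFun (congrFun (hblock i j) a) b
  rw [Matrix.sum_apply] at this
  rw [Matrix.mul_apply, Fintype.sum_prod_type]
  refine Eq.trans (Finset.sum_congr rfl fun k _ => ?_) (this.trans ?_)
  · rw [Matrix.mul_apply]; rfl
  · by_cases hij : i = j <;> simp [hij, Matrix.one_apply]

/-- The part of the bidiagonal matrix that is linear in the gains. -/
noncomputable def bidiagonalLinear : Gains n nu N →ₗ[ℝ] Matrix (Fin N × Fin n) (Fin N × Fin n) ℝ where
  toFun K := .of fun p q =>
    (if h : (p.1 : ℕ) = (q.1 : ℕ) + 1 then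
      -((D p.1)⁻¹ * (B p.1 * K ⟨p.1, by omega⟩))
    else 0 : Matrix (Fin n) (Fin n) ℝ) p.2 q.2
  map_add' K K' := by
    ext p q
    by_cases h : (p.1 : ℕ) = (q.1 : ℕ) + 1
    · simp only [Matrix.of_apply, Matrix.add_apply, dif_pos h, Pi.add_apply, Matrix.mul_add, neg_add]
    · simp [h]
  map_smul' c K := by
    ext p q
    by_cases h : (p.1 : ℕ) = (q.1 : ℕ) + 1
    · simp [h]
    · simp [h]

/-- The bidiagonal matrix as an affine function of the gains. -/
noncomputable def bidiagonalAffine : Gains n nu N →ᵃ[ℝ] Matrix (Fin N × Fin n) (Fin N × Fin n) ℝ :=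
  -- Zero gains leave the constant part: blocks `D_i⁻¹` and `-D_i⁻¹ A_i`.
  (bidiagonalLinear B D).toAffineMap + AffineMap.const ℝ _ (bidiagonalMatrix A B D 0)

theorem bidiagonalAffine_apply (K : Gains n nu N) :
    bidiagonalAffine A B D K = bidiagonalMatrix A B D K := by
  ext p q
  by_cases h : (p.1 : ℕ) = (q.1 : ℕ) + 1
  · have h1 : ¬ p.1 = q.1 := fun h' => by rw [h'] at h; omega
    have h2 : (q.1 : ℕ) + 1 < N := h ▸ p.1.2
    simp [bidiagonalAffine, bidiagonalLinear, bidiagonalMatrix, closedLoop, h, h1, h2,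
      Matrix.mul_add]
  · simp [bidiagonalAffine, bidiagonalLinear, bidiagonalMatrix, h]

end Response

theorem mainTheorem1 (n nu N : ℕ)
    (A : ℕ → Matrix (Fin n) (Fin n) ℝ) (B : ℕ → Matrix (Fin n) (Fin nu) ℝ)
    (D : ℕ → Matrix (Fin n) (Fin n) ℝ) (hD : ∀ t < N, IsUnit (D t))
    (f : (Fin (Fintype.card (Fin N × Fin n)) → ℝ) → EReal)
    (hf_symm : AbsolutelySymmetric f) (hf_lsc : LowerSemicontinuous f)
    (hf_conv : ExtConvexOn Set.univ f)
    (R : Gains n nu N → EReal) (hR : ExtConvexOn Set.univ R)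
    (C : Set (Gains n nu N)) (hC : Convex ℝ C) :
    (∀ K : Gains n nu N, IsUnit (responseMatrix A B D K) ∧
      (responseMatrix A B D K)⁻¹ = bidiagonalMatrix A B D K) ∧
    (∃ L : Gains n nu N →ᵃ[ℝ] Matrix (Fin N × Fin n) (Fin N × Fin n) ℝ,
      ∀ K, L K = (responseMatrix A B D K)⁻¹) ∧
    IsConvexProblem C
      (fun K => f (singularValueVector (responseMatrix A B D K)⁻¹) + R K) := by
  have hmul := bidiagonalMatrix_mul_responseMatrix A B D hD
  have hinv : ∀ K : Gains n nu N, (responseMatrix A B D K)⁻¹ = bidiagonalMatrix A B D K :=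
    fun K => Matrix.inv_eq_left_inv (hmul K)
  -- For square matrices a left inverse suffices.
  refine ⟨fun K => ⟨IsUnit.of_mul_eq_one_right _ (hmul K), hinv K⟩,
    ⟨bidiagonalAffine A B D, fun K => by rw [bidiagonalAffine_apply, hinv]⟩, hC, ?_⟩
  have hcomp := (hf_conv.comp_singularValueVector hf_symm).comp_affineMap (bidiagonalAffine A B D)
  simp only [bidiagonalAffine_apply, ← hinv] at hcomp
  exact (hcomp.add hR).mono (Set.subset_univ C) hC
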